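/- **Model.** A base station serves $M\ge 1$ clients over $K\ge 1$ frames, each consisting of $T\ge 1$ slots. At the start of every frame a new packet is generated for every client, replacing any undelivered packet of the previous frame. In each slot $(k,n)$, $1\le k\le K$, $1\le n\le T$, the scheduler either idles or transmits to one client whose packet of frame $k$ is still undelivered; a transmission to client $i$ in that slot succeeds iff the channel of client $i$ is ON, and the scheduler learns the outcome immediately. The channel of client $i$ is ON with probability $p_i\in(0,1]$ in each slot, independently over slots and clients. Let $h_{1,i}\ge 1$ be given integers and let $h_{k+1,i}=1$ if client $i$ receives its packet during frame $k$, and $h_{k+1,i}=h_{k,i}+1$ otherwise. For weights $\alpha_i>0$ put $$J_K=\frac1{KM}\sum_{k=1}^K\sum_{i=1}^M\alpha_i h_{k,i},\qquad \mathrm{EWSAoI}=\frac1{KTM}\,\mathbb E\Big[\sum_{k=1}^K\sum_{i=1}^M\alpha_i\Big(\frac{T^2}{2}+T^2h_{k,i}\Big)\Big].$$ A policy (possibly randomized) is *non-anticipative* if its decision in each slot is a function of information which contains the feedback from all earlier transmissions and is independent of the channel states in the present and later slots. $\Pi$ is the class of all non-anticipative policies. A policy in $\Pi$ is *Greedy*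 if in each slot $(k,n)$ it transmits to a client with the highest value of $h_{k,i}$ among the clients with an undelivered packet, ties being broken arbitrarily (but non-anticipatively), and idles only if all packets of frame $k$ have been delivered. **Theorem (Optimality of Greedy).** Consider a symmetric network: $p_i=p\in(0,1]$ and $\alpha_i=\alpha>0$ for all $i$, with arbitrary $M,T,K\ge1$ and $h_{1,i}\ge 1$. Then Greedy policies exist in $\Pi$, and every Greedy policy $G$ minimizes the expected weighted sum Age of Information over $\Pi$: $J_K^{G}$ and $J_K^{\pi}$ are integrable and $$\mathbb E[J_K^{G}]\le \mathbb E[J_K^{\pi}]\quad\text{and}\quad \mathrm{EWSAoI}^{G}\le\mathrm{EWSAoI}^{\pi}\qquad\text{for every }\pi\in\Pi .$$ -/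

import Mathlib

open MeasureTheory ProbabilityTheory

/-- A single-hop broadcast network over a finite horizon: `M` clients, `T` slots per frame, `K`
frames, channel reliabilities `p i ∈ (0,1]`, weights `α i > 0`, and initial ages `h₁ i ≥ 1`
(measured in frames). Frames, slots and clients are numbered from `0`. -/
structure AoINetwork where
  M : ℕ
  T : ℕ
  K : ℕ
  M_pos : 0 < M
  T_pos : 0 < T
  K_pos : 0 < K
  p : Fin M → ℝ
  p_mem : ∀ i, p i ∈ Set.Ioc (0 : ℝ) 1
  α : Fin M → ℝ
  α_pos : ∀ i, 0 < α i
  h₁ : Fin M → ℕ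
  h₁_pos : ∀ i, 1 ≤ h₁ i

namespace AoINetwork

/-- Global index of the slot `n` (with `n < T`) of the frame `k`. -/
def slot (N : AoINetwork) (k n : ℕ) : ℕ := k * N.T + n

/-- The clients whose packet of frame `k` is delivered during the first `n` slots of that frame,
when `a t` is the decision in slot `t` (`none` means idle) and `e t i` says whether the channel of
client `i` is ON in slot `t`. -/
def delivered (N : AoINetwork) (a : ℕ → Option (Fin N.M)) (e : ℕ → Fin N.M → Bool)
    (k n : ℕ) : Set (Fin N.M) :=
  {i | ∃ m < n, a (N.slot k m) = some i ∧ e (N.slot k m) i = true}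

open Classical in
/-- The number `h_{k,i}` of frames since the last delivery to client `i`, at the start of
frame `k`. -/
noncomputable def age (N : AoINetwork) (a : ℕ → Option (Fin N.M)) (e : ℕ → Fin N.M → Bool) :
    ℕ → Fin N.M → ℕ
  | 0, i => N.h₁ i
  | k + 1, i => if i ∈ N.delivered a e k N.T then 1 else N.age a e k i + 1

/-- Channel states of the network on a probability space: `E t i` is ON (`true`) with probability
`p i`, independently over all slots `t` and clients `i`. -/
structure Channels (N : AoINetwork) {Ω : Type*} [MeasurableSpace Ω] (μ : Measure Ω) where
  E : ℕ → Fin N.M → Ω → Bool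
  measurable_E : ∀ t i, Measurable (E t i)
  law_E : ∀ t i, μ {ω | E t i ω = true} = ENNReal.ofReal (N.p i)
  indep_E : iIndepFun (fun (x : ℕ × Fin N.M) => E x.1 x.2) μ

/-- A non-anticipative scheduling policy, possibly randomized. In slot `t` it takes the decision
`act t` on the basis of the information `info t`. The information contains the feedback from all
earlier transmissions, and may contain anything else (private randomization, side information),
as long as it is independent of the channel states in slot `t` and later. Only clients with an
undelivered packet may be selected. -/
structure Policy (N : AoINetwork) {Ω : Type*} [mΩ : MeasurableSpace Ω] {μ : Measure Ω}
    (C : N.Channels μ) where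
  info : Filtration ℕ mΩ
  act : ℕ → Ω → Option (Fin N.M)
  act_measurable : ∀ t a, MeasurableSet[info t] {ω | act t ω = a}
  feedback_measurable : ∀ t i,
    MeasurableSet[info (t + 1)] {ω | act t ω = some i ∧ C.E t i ω = true}
  nonanticipative : ∀ t,
    Indep (info t) (⨆ (s : ℕ) (_ : t ≤ s) (i : Fin N.M), MeasurableSpace.comap (C.E s i) ⊤) μ
  undelivered : ∀ k, ∀ n < N.T, ∀ ω i, act (N.slot k n) ω = some i →
    i ∉ N.delivered (fun t => act t ω) (fun t j => C.E t j ω) k n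

namespace Policy

variable {N : AoINetwork} {Ω : Type*} [MeasurableSpace Ω] {μ : Measure Ω} {C : N.Channels μ}

/-- The clients that already received their packet of frame `k` at the start of its slot `n`. -/
def delivered (π : N.Policy C) (k n : ℕ) (ω : Ω) : Set (Fin N.M) :=
  N.delivered (fun t => π.act t ω) (fun t i => C.E t i ω) k n

/-- The ages `h_{k,i}` under the policy. -/
noncomputable def age (π : N.Policy C) (k : ℕ) (i : Fin N.M) (ω : Ω) : ℕ :=
  N.age (fun t => π.act t ω) (fun t j => C.E t j ω) k i

/-- The policy is Greedy: in every slot of the horizon it selects, among the clients with an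
undelivered packet, one of highest age (ties being broken arbitrarily), and it idles only if every
packet of the frame has been delivered. -/
def IsGreedy (π : N.Policy C) : Prop :=
  ∀ k < N.K, ∀ n < N.T, ∀ ω,
    match π.act (N.slot k n) ω with
    | some i => i ∉ π.delivered k n ω ∧
        ∀ j, j ∉ π.delivered k n ω → π.age k j ω ≤ π.age k i ω
    | none => ∀ j, j ∈ π.delivered k n ω

/-- `J_K = (1 / (K M)) ∑_k ∑_i α_i h_{k,i}`. -/
noncomputable def J (π : N.Policy C) (ω : Ω) : ℝ :=
  1 / ((N.K : ℝ) * N.M) *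
    ∑ k ∈ Finset.range N.K, ∑ i : Fin N.M, N.α i * (π.age k i ω : ℝ)

/-- `E[J_K]`. -/
noncomputable def expectedJ (π : N.Policy C) : ℝ := ∫ ω, π.J ω ∂μ

/-- The expected weighted sum Age of Information: the area under the age curve of client `i`
during frame `k` is `T² / 2 + T² h_{k,i}`. -/
noncomputable def EWSAoI (π : N.Policy C) : ℝ :=
  1 / ((N.K : ℝ) * N.T * N.M) *
    ∫ ω, ∑ k ∈ Finset.range N.K, ∑ i : Fin N.M,
      N.α i * ((N.T : ℝ) ^ 2 / 2 + (N.T : ℝ) ^ 2 * (π.age k i ω : ℝ)) ∂μ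

end Policy

end AoINetwork

namespace AoINetwork

section Trajectory

variable (N : AoINetwork) (a : ℕ → Option (Fin N.M)) (e : ℕ → Fin N.M → Bool)

open Classical in
/-- The number of clients that still wait for their packet at the start of slot `n` of frame `k`
and whose age exceeds `c`. -/
noncomputable def tail (k n c : ℕ) : ℕ :=
  (Finset.univ.filter fun i => i ∉ N.delivered a e k n ∧ c < N.age a e k i).card

theorem delivered_zero (k : ℕ) : N.delivered a e k 0 = ∅ := by
  simp [delivered]

theorem mem_delivered_succ {k n : ℕ} {i : Fin N.M} :
    i ∈ N.delivered a e k (n + 1) ↔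
      i ∈ N.delivered a e k n ∨ (a (N.slot k n) = some i ∧ e (N.slot k n) i = true) := by
  simp only [delivered, Set.mem_ofPred_eq, Nat.lt_succ_iff_lt_or_eq]
  constructor
  · rintro ⟨m, hm | rfl, h⟩
    · exact Or.inl ⟨m, hm, h⟩
    · exact Or.inr h
  · rintro (⟨m, hm, h⟩ | h)
    · exact ⟨m, Or.inl hm, h⟩
    · exact ⟨n, Or.inr rfl, h⟩

theorem slot_succ_zero (k : ℕ) : N.slot (k + 1) 0 = N.slot k N.T := by
  simp [slot, Nat.succ_mul]

theorem age_pos (k : ℕ) (i : Fin N.M) : 1 ≤ N.age a e k i := by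
  cases k with
  | zero => exact N.h₁_pos i
  | succ k => rw [age]; split_ifs <;> omega

theorem age_le (k : ℕ) (i : Fin N.M) : N.age a e k i ≤ N.h₁ i + k := by
  induction k with
  | zero => simp [age]
  | succ k ih => rw [age]; split_ifs <;> omega

variable {a e}

theorem tail_succ_of_not_success {k n : ℕ}
    (h : ∀ i, a (N.slot k n) = some i → e (N.slot k n) i = false) :
    N.tail a e k (n + 1) = N.tail a e k n := by
  funext c
  unfold tail
  congr 1
  ext i
  have hi := h i
  simp only [Finset.mem_filter, Finset.mem_univ, true_and, mem_delivered_succ]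
  by_cases hs : a (N.slot k n) = some i <;> simp_all

theorem tail_sub_one_le_tail_succ {k n : ℕ} {i : Fin N.M} (h : a (N.slot k n) = some i) (c : ℕ) :
    N.tail a e k n c - 1 ≤ N.tail a e k (n + 1) c := by
  classical
  unfold tail
  refine le_trans ?_ (Finset.card_le_card (s := (Finset.univ.filter fun j =>
    j ∉ N.delivered a e k n ∧ c < N.age a e k j).erase i) ?_)
  · exact Finset.pred_card_le_card_erase
  · intro j
    simp only [Finset.mem_erase, Finset.mem_filter, Finset.mem_univ, true_and,
      mem_delivered_succ, h, Option.some.injEq]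
    rintro ⟨hj, h₁, h₂⟩
    exact ⟨fun h' => h'.elim h₁ fun h'' => hj h''.1.symm, h₂⟩

theorem tail_succ_of_success {k n : ℕ} {i : Fin N.M} (h : a (N.slot k n) = some i)
    (he : e (N.slot k n) i = true) (hi : i ∉ N.delivered a e k n)
    (hmax : ∀ j, j ∉ N.delivered a e k n → N.age a e k j ≤ N.age a e k i) :
    N.tail a e k (n + 1) = fun c => N.tail a e k n c - 1 := by
  classical
  funext c
  unfold tail
  by_cases hc : c < N.age a e k i
  · rw [← Finset.card_erase_of_mem (a := i) (by simp [hi, hc])]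
    congr 1
    ext j
    simp only [Finset.mem_erase, Finset.mem_filter, Finset.mem_univ, true_and,
      mem_delivered_succ, h, Option.some.injEq]
    constructor
    · rintro ⟨h₁, h₂⟩
      refine ⟨?_, fun h' => h₁ (Or.inl h'), h₂⟩
      rintro rfl
      exact h₁ (Or.inr ⟨rfl, he⟩)
    · rintro ⟨hj, h₁, h₂⟩
      exact ⟨fun h' => h'.elim h₁ fun h'' => hj h''.1.symm, h₂⟩
  · have h0 : ∀ j, j ∉ N.delivered a e k n → ¬ c < N.age a e k j := fun j hj h' =>
      hc (h'.trans_le (hmax j hj))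
    rw [Finset.filter_false_of_mem (by
      rintro j - ⟨h₁, h₂⟩
      exact h0 j (fun h' => h₁ ((mem_delivered_succ N a e).2 (Or.inl h'))) h₂),
      Finset.filter_false_of_mem (by
      rintro j - ⟨h₁, h₂⟩
      exact h0 j h₁ h₂)]
    simp

theorem tail_eq_zero_of_all_delivered {k n : ℕ} (h : ∀ i, i ∈ N.delivered a e k n) :
    N.tail a e k n = 0 := by
  funext c
  simp [tail, h]

variable (a e)

/-- The change of the tail counts at the end of a frame: all ages grow by one. -/
def shift (N : AoINetwork) (x : ℕ → ℕ) : ℕ → ℕ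
  | 0 => N.M
  | c + 1 => x c

theorem tail_succ_zero (k : ℕ) : N.tail a e (k + 1) 0 = N.shift (N.tail a e k N.T) := by
  funext c
  cases c with
  | zero =>
    have : ∀ i, 0 < N.age a e (k + 1) i := fun i => N.age_pos a e (k + 1) i
    simp [tail, shift, delivered_zero, this]
  | succ c =>
    simp only [tail, shift, delivered_zero]
    congr 1
    ext i
    by_cases hi : i ∈ N.delivered a e k N.T <;> simp [age, hi]

theorem sum_age_eq_sum_tail {k B : ℕ} (hB : ∀ i, N.age a e k i ≤ B) :
    ∑ i, N.age a e k i = ∑ c ∈ Finset.range B, N.tail a e k 0 c := by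
  classical
  have h : ∀ i, N.age a e k i =
      ∑ c ∈ Finset.range B, if c < N.age a e k i then 1 else 0 := by
    intro i
    rw [← Finset.card_filter]
    have : (Finset.range B).filter (fun c => c < N.age a e k i) =
        Finset.range (N.age a e k i) := by
      ext c
      have := hB i
      simp only [Finset.mem_filter, Finset.mem_range]
      omega
    rw [this, Finset.card_range]
  calc ∑ i, N.age a e k i
      = ∑ i, ∑ c ∈ Finset.range B, if c < N.age a e k i then 1 else 0 :=
        Finset.sum_congr rfl fun i _ => h i
    _ = ∑ c ∈ Finset.range B, N.tail a e k 0 c := by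
        rw [Finset.sum_comm]
        refine Finset.sum_congr rfl fun c _ => ?_
        simp [tail, delivered_zero]

theorem delivered_congr {a a' : ℕ → Option (Fin N.M)} {e e' : ℕ → Fin N.M → Bool} {k n : ℕ}
    (ha : ∀ s < N.slot k n, a s = a' s) (he : ∀ s < N.slot k n, e s = e' s) :
    N.delivered a e k n = N.delivered a' e' k n := by
  ext i
  simp only [delivered, Set.mem_ofPred_eq]
  refine exists_congr fun m => and_congr_right fun hm => ?_
  have : N.slot k m < N.slot k n := by simpa [slot] using hm
  rw [ha _ this, he _ this]

theorem age_congr {a a' : ℕ → Option (Fin N.M)} {e e' : ℕ → Fin N.M → Bool} {k : ℕ}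
    (ha : ∀ s < N.slot k 0, a s = a' s) (he : ∀ s < N.slot k 0, e s = e' s) :
    N.age a e k = N.age a' e' k := by
  induction k with
  | zero => rfl
  | succ k ih =>
    rw [slot_succ_zero] at ha he
    have hle : N.slot k 0 ≤ N.slot k N.T := by simp [slot]
    funext i
    rw [age, age, delivered_congr N ha he, ih (fun s hs => ha s (hs.trans_le hle))
      (fun s hs => he s (hs.trans_le hle))]

end Trajectory

section GreedyAct

open Classical in
/-- A client of highest age among those outside `D`, if there is one. -/
noncomputable def oldest (N : AoINetwork) (D : Set (Fin N.M)) (h : Fin N.M → ℕ) :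
    Option (Fin N.M) :=
  if H : ∃ i, i ∉ D ∧ ∀ j, j ∉ D → h j ≤ h i then some H.choose else none

theorem oldest_spec (N : AoINetwork) (D : Set (Fin N.M)) (h : Fin N.M → ℕ) :
    match N.oldest D h with
    | some i => i ∉ D ∧ ∀ j, j ∉ D → h j ≤ h i
    | none => ∀ j, j ∈ D := by
  unfold oldest
  split_ifs with H
  · exact H.choose_spec
  · intro j
    by_contra hj
    obtain ⟨i, hi, hmax⟩ := Set.exists_max_image Dᶜ h (Set.toFinite _) ⟨j, hj⟩
    exact H ⟨i, hi, fun j hj => hmax j hj⟩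

/-- The decisions of the greedy scheduler in the first `t` slots (idling afterwards). -/
noncomputable def greedyPrefix (N : AoINetwork) (e : ℕ → Fin N.M → Bool) :
    ℕ → ℕ → Option (Fin N.M)
  | 0 => fun _ => none
  | t + 1 => Function.update (greedyPrefix N e t) t
      (N.oldest (N.delivered (greedyPrefix N e t) e (t / N.T) (t % N.T))
        (N.age (greedyPrefix N e t) e (t / N.T)))

/-- The decision of the greedy scheduler in slot `t`. -/
noncomputable def greedyAct (N : AoINetwork) (e : ℕ → Fin N.M → Bool) (t : ℕ) :
    Option (Fin N.M) :=
  N.greedyPrefix e (t + 1) t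

variable (N : AoINetwork)

theorem greedyPrefix_eq_greedyAct (e : ℕ → Fin N.M → Bool) {s t : ℕ} (h : s < t) :
    N.greedyPrefix e t s = N.greedyAct e s := by
  induction t with
  | zero => omega
  | succ t ih =>
    rcases Nat.lt_succ_iff_lt_or_eq.1 h with h' | rfl
    · rw [greedyPrefix, Function.update_of_ne h'.ne, ih h']
    · rfl

theorem greedyPrefix_congr {e e' : ℕ → Fin N.M → Bool} {t : ℕ} (h : ∀ s, s + 1 < t → e s = e' s) :
    N.greedyPrefix e t = N.greedyPrefix e' t := by
  induction t with
  | zero => rfl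
  | succ t ih =>
    have hs : t / N.T * N.T + t % N.T = t := Nat.div_add_mod' t N.T
    rw [greedyPrefix, greedyPrefix, ih fun s hs => h s (by omega),
      delivered_congr N (fun _ _ => rfl) (e' := e') (fun s hs' => h s (by
        rw [slot, hs] at hs'; omega)),
      age_congr N (fun _ _ => rfl) (e' := e') (fun s hs' => h s (by
        rw [slot] at hs'; omega))]

theorem greedyAct_congr {e e' : ℕ → Fin N.M → Bool} {t : ℕ} (h : ∀ s < t, e s = e' s) :
    N.greedyAct e t = N.greedyAct e' t :=
  congrFun (N.greedyPrefix_congr fun s hs => h s (by omega)) t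

theorem greedyAct_slot (e : ℕ → Fin N.M → Bool) {k n : ℕ} (hn : n < N.T) :
    N.greedyAct e (N.slot k n) = N.oldest (N.delivered (N.greedyAct e) e k n)
      (N.age (N.greedyAct e) e k) := by
  have hd : N.slot k n / N.T = k := by
    rw [slot, Nat.mul_comm, Nat.mul_add_div N.T_pos, Nat.div_eq_of_lt hn, Nat.add_zero]
  have hm : N.slot k n % N.T = n := by
    rw [slot, Nat.mul_comm, Nat.mul_add_mod, Nat.mod_eq_of_lt hn]
  have hle : N.slot k 0 ≤ N.slot k n := by simp [slot]
  rw [greedyAct, greedyPrefix, Function.update_self, hd, hm,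
    delivered_congr N (fun s hs => N.greedyPrefix_eq_greedyAct e hs) (fun _ _ => rfl),
    age_congr N (fun s hs => N.greedyPrefix_eq_greedyAct e (hs.trans_le hle)) (fun _ _ => rfl)]

end GreedyAct

end AoINetwork

open scoped ENNReal

/-- One-step conditioning: if a decision `A` and two costs are known before the coins `e i`, all of
which show `true` with probability `q` and are independent of that knowledge, then the coin of the
chosen index picks the cost `F₁` with probability `q`. -/
theorem lintegral_choose_coin {Ω ι : Type*} [Fintype ι] {m mΩ : MeasurableSpace Ω} {μ : Measure Ω}
    [IsProbabilityMeasure μ] (hm : m ≤ mΩ)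
    {A : Ω → Option ι} (hA : ∀ a, MeasurableSet[m] {ω | A ω = a})
    {e : ι → Ω → Bool} (he : ∀ i, Measurable (e i))
    (hind : ∀ i, Indep m (MeasurableSpace.comap (e i) ⊤) μ)
    {q : ℝ≥0∞} (hq : ∀ i, μ {ω | e i ω = true} = q)
    {F₀ F₁ : Ω → ℝ≥0∞} (h₀ : Measurable[m] F₀) (h₁ : Measurable[m] F₁) :
    ∫⁻ ω, (A ω).elim (q * F₁ ω + (1 - q) * F₀ ω)
      (fun i => if e i ω = true then F₁ ω else F₀ ω) ∂μ
    = ∫⁻ ω, q * F₁ ω + (1 - q) * F₀ ω ∂μ := by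
  have hA' : ∀ a, MeasurableSet {ω | A ω = a} := fun a => hm _ (hA a)
  have hdisj : Pairwise (Function.onFun Disjoint fun a => {ω | A ω = a}) := by
    intro a b hab
    refine Set.disjoint_left.2 fun ω h h' => hab ?_
    simp only [Set.mem_ofPred_eq] at h h'
    exact h.symm.trans h'
  have hcover : (⋃ a, {ω | A ω = a}) = Set.univ := by
    ext ω; simp
  have split : ∀ F : Ω → ℝ≥0∞, ∫⁻ ω, F ω ∂μ = ∑' a, ∫⁻ ω in {ω | A ω = a}, F ω ∂μ := by
    intro F
    rw [← lintegral_iUnion hA' hdisj, hcover, Measure.restrict_univ]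
  have key : ∀ (i : ι) (b : Bool) (F : Ω → ℝ≥0∞), Measurable[m] F →
      ∫⁻ ω, ({ω | A ω = some i}.indicator F ω) * ({ω | e i ω = b}.indicator 1 ω) ∂μ
        = μ {ω | e i ω = b} * ∫⁻ ω in {ω | A ω = some i}, F ω ∂μ := by
    intro i b F hF
    have hb : MeasurableSet[MeasurableSpace.comap (e i) ⊤] {ω | e i ω = b} :=
      ⟨{b}, trivial, rfl⟩
    have hone : Measurable[MeasurableSpace.comap (e i) ⊤]
        ({ω | e i ω = b}.indicator (1 : Ω → ℝ≥0∞)) :=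
      Measurable.indicator (@measurable_const _ _ _ (MeasurableSpace.comap (e i) ⊤) 1) hb
    rw [lintegral_mul_eq_lintegral_mul_lintegral_of_independent_measurableSpace hm
      (he i).comap_le (hind i) (Measurable.indicator hF (hA _))
      hone, lintegral_indicator (hA' _),
      lintegral_indicator_one ((he i).comap_le _ hb), mul_comm]
  have hq' : ∀ i, μ {ω | e i ω = false} = 1 - q := by
    intro i
    have h : MeasurableSet {ω | e i ω = true} := he i (measurableSet_singleton true)
    rw [← hq i, ← prob_compl_eq_one_sub h]
    congr 1
    ext ω; simp
  rw [split, split]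
  congr 1
  funext a
  cases a with
  | none =>
    refine setLIntegral_congr_fun (hA' _) fun ω hω => ?_
    simp only [Set.mem_ofPred_eq] at hω
    simp [hω]
  | some i =>
    have hF₁ : Measurable F₁ := h₁.mono hm le_rfl
    have hF₀ : Measurable F₀ := h₀.mono hm le_rfl
    have hmeas : Measurable fun ω => ({ω | A ω = some i}.indicator F₁ ω) *
        ({ω | e i ω = true}.indicator 1 ω) :=
      (hF₁.indicator (hA' _)).mul
        (measurable_one.indicator (he i (measurableSet_singleton true)))
    rw [lintegral_add_left (hF₁.const_mul q), lintegral_const_mul _ hF₁,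
      lintegral_const_mul _ hF₀, ← hq i, ← key i true F₁ h₁, hq i, ← hq' i, ← key i false F₀ h₀,
      ← lintegral_add_left hmeas, ← lintegral_indicator (hA' _)]
    refine lintegral_congr fun ω => ?_
    by_cases hω : A ω = some i
    · cases hb : e i ω <;> simp [Set.indicator, hω, hb]
    · simp [Set.indicator, hω]

/-- The expected value of `f` after a slot that lowers all tail counts with probability `q`. -/
noncomputable def slotOp (q : ℝ≥0∞) (f : (ℕ → ℕ) → ℝ≥0∞) (x : ℕ → ℕ) : ℝ≥0∞ :=
  q * f (fun c => x c - 1) + (1 - q) * f x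

theorem Monotone.slotOp {q : ℝ≥0∞} {f : (ℕ → ℕ) → ℝ≥0∞} (hf : Monotone f) :
    Monotone (slotOp q f) := fun x y h => by
  unfold _root_.slotOp
  gcongr
  · exact hf fun c => Nat.sub_le_sub_right (h c) 1
  · exact hf h

theorem measurable_sub_one_tail : Measurable fun (x : ℕ → ℕ) (c : ℕ) => x c - 1 :=
  measurable_pi_lambda _ fun c => (measurable_pi_apply c).sub_const 1

theorem Measurable.slotOp {q : ℝ≥0∞} {f : (ℕ → ℕ) → ℝ≥0∞} (hf : Measurable f) :
    Measurable (slotOp q f) :=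
  ((hf.comp measurable_sub_one_tail).const_mul q).add (hf.const_mul (1 - q))

theorem slotOp_le {q : ℝ≥0∞} (hq : q ≤ 1) {f : (ℕ → ℕ) → ℝ≥0∞} (hf : Monotone f) (x : ℕ → ℕ) :
    slotOp q f x ≤ f x := by
  calc slotOp q f x ≤ q * f x + (1 - q) * f x := by
        unfold slotOp
        gcongr
        exact hf fun c => Nat.sub_le _ _
    _ = f x := by rw [← add_mul, add_tsub_cancel_of_le hq, one_mul]

theorem slotOp_eq_of_eq_zero {q : ℝ≥0∞} (hq : q ≤ 1) (f : (ℕ → ℕ) → ℝ≥0∞) :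
    slotOp q f 0 = f 0 := by
  change q * f 0 + (1 - q) * f 0 = f 0
  rw [← add_mul, add_tsub_cancel_of_le hq, one_mul]

theorem Monotone.slotOp_iterate {q : ℝ≥0∞} {f : (ℕ → ℕ) → ℝ≥0∞} (hf : Monotone f) (n : ℕ) :
    Monotone ((_root_.slotOp q)^[n] f) := by
  induction n with
  | zero => exact hf
  | succ n ih => rw [Function.iterate_succ_apply']; exact ih.slotOp

theorem Measurable.slotOp_iterate {q : ℝ≥0∞} {f : (ℕ → ℕ) → ℝ≥0∞} (hf : Measurable f) (n : ℕ) :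
    Measurable ((_root_.slotOp q)^[n] f) := by
  induction n with
  | zero => exact hf
  | succ n ih => rw [Function.iterate_succ_apply']; exact ih.slotOp

namespace AoINetwork

/-- The expected value of `f` after a whole frame under the greedy scheduler. -/
noncomputable def frameOp (N : AoINetwork) (q : ℝ≥0∞) (f : (ℕ → ℕ) → ℝ≥0∞) :
    (ℕ → ℕ) → ℝ≥0∞ :=
  (slotOp q)^[N.T] fun x => f (N.shift x)

variable (N : AoINetwork)

theorem monotone_shift : Monotone N.shift := fun x y h c => by
  cases c with
  | zero => exact le_rfl
  | succ c => exact h c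

theorem measurable_shift : Measurable N.shift :=
  measurable_pi_lambda _ fun c => by
    cases c with
    | zero => exact measurable_const
    | succ c => exact measurable_pi_apply c

theorem monotone_frameOp {q : ℝ≥0∞} {f : (ℕ → ℕ) → ℝ≥0∞} (hf : Monotone f) :
    Monotone (N.frameOp q f) :=
  Monotone.slotOp_iterate (hf.comp N.monotone_shift) N.T

theorem measurable_frameOp {q : ℝ≥0∞} {f : (ℕ → ℕ) → ℝ≥0∞} (hf : Measurable f) :
    Measurable (N.frameOp q f) :=
  Measurable.slotOp_iterate (hf.comp N.measurable_shift) N.T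

namespace Policy

variable {N} {Ω : Type*} [MeasurableSpace Ω] {μ : Measure Ω} {C : N.Channels μ} (π : N.Policy C)

/-- The tail counts of the ages of the waiting clients under the policy. -/
noncomputable def tail (k n : ℕ) (ω : Ω) : ℕ → ℕ :=
  N.tail (fun t => π.act t ω) (fun t j => C.E t j ω) k n

theorem measurableSet_delivered {k n : ℕ} (i : Fin N.M) :
    MeasurableSet[π.info (N.slot k n)] {ω | i ∈ π.delivered k n ω} := by
  have : {ω | i ∈ π.delivered k n ω} =
      ⋃ m ∈ Finset.range n, {ω | π.act (N.slot k m) ω = some i ∧ C.E (N.slot k m) i ω = true} := by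
    ext ω
    simp only [Policy.delivered, AoINetwork.delivered, Set.mem_ofPred_eq, Set.mem_iUnion,
      Finset.mem_range, exists_prop]
  rw [this]
  refine Finset.measurableSet_biUnion _ fun m hm => ?_
  refine π.info.mono ?_ _ (π.feedback_measurable (N.slot k m) i)
  have := Finset.mem_range.1 hm
  simp only [slot]
  omega

theorem measurable_age (k : ℕ) (i : Fin N.M) : Measurable[π.info (N.slot k 0)] (π.age k i) := by
  classical
  induction k with
  | zero => exact measurable_const
  | succ k ih =>
    have h : π.age (k + 1) i =
        fun ω => if i ∈ π.delivered k N.T ω then 1 else π.age k i ω + 1 := by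
      funext ω
      simp only [Policy.age, AoINetwork.age]
      rfl
    rw [h, slot_succ_zero]
    have hle : π.info (N.slot k 0) ≤ π.info (N.slot k N.T) := π.info.mono (by simp [slot])
    exact Measurable.ite (π.measurableSet_delivered i) measurable_const
      ((ih.mono hle le_rfl).add_const 1)

theorem measurable_tail (k n : ℕ) : Measurable[π.info (N.slot k n)] (π.tail k n) := by
  classical
  refine @measurable_pi_lambda _ _ _ (π.info (N.slot k n)) _ _ fun c => ?_
  have h : (fun ω => π.tail k n ω c) = fun ω =>
      ∑ i, if i ∉ π.delivered k n ω ∧ c < π.age k i ω then 1 else 0 := by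
    funext ω
    simp only [tail, AoINetwork.tail, Finset.card_filter]
    refine Finset.sum_congr rfl fun i _ => ?_
    congr 1
  rw [h]
  have hle : π.info (N.slot k 0) ≤ π.info (N.slot k n) := π.info.mono (by simp [slot])
  refine Finset.measurable_sum _ fun i _ => Measurable.ite ?_ measurable_const measurable_const
  exact (π.measurableSet_delivered i).compl.inter
    (((π.measurable_age k i).mono hle le_rfl) (measurableSet_Ioi (a := c)))

theorem tail_succ_zero (k : ℕ) (ω : Ω) : π.tail (k + 1) 0 ω = N.shift (π.tail k N.T ω) :=
  N.tail_succ_zero _ _ k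

variable [IsProbabilityMeasure μ] {q : ℝ≥0∞}

/-- The expectation of `slotOp q f` written as that of the outcome of the transmission in a slot. -/
theorem lintegral_slotOp_tail (hq : ∀ i, ENNReal.ofReal (N.p i) = q) {f : (ℕ → ℕ) → ℝ≥0∞}
    (hf : Measurable f) (k n : ℕ) :
    ∫⁻ ω, (π.act (N.slot k n) ω).elim (slotOp q f (π.tail k n ω))
      (fun i => if C.E (N.slot k n) i ω = true then f (fun c => π.tail k n ω c - 1)
        else f (π.tail k n ω)) ∂μ
    = ∫⁻ ω, slotOp q f (π.tail k n ω) ∂μ := by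
  refine lintegral_choose_coin (π.info.le _) (fun a => π.act_measurable (N.slot k n) a)
    (e := fun i => C.E (N.slot k n) i) (fun i => C.measurable_E _ i) (fun i => ?_)
    (fun i => (C.law_E _ i).trans (hq i))
    (F₀ := fun ω => f (π.tail k n ω)) (F₁ := fun ω => f (fun c => π.tail k n ω c - 1))
    (hf.comp (π.measurable_tail k n))
    (hf.comp (measurable_sub_one_tail.comp (π.measurable_tail k n)))
  exact indep_of_indep_of_le_right (π.nonanticipative (N.slot k n))
    (le_iSup₂_of_le (N.slot k n) le_rfl (le_iSup_of_le i le_rfl))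

theorem lintegral_slotOp_tail_le (hq : ∀ i, ENNReal.ofReal (N.p i) = q) (hq1 : q ≤ 1)
    {f : (ℕ → ℕ) → ℝ≥0∞} (hf : Measurable f) (hmono : Monotone f) (k n : ℕ) :
    ∫⁻ ω, slotOp q f (π.tail k n ω) ∂μ ≤ ∫⁻ ω, f (π.tail k (n + 1) ω) ∂μ := by
  rw [← π.lintegral_slotOp_tail hq hf]
  refine lintegral_mono fun ω => ?_
  cases ha : π.act (N.slot k n) ω with
  | none =>
    have : π.tail k (n + 1) ω = π.tail k n ω :=
      tail_succ_of_not_success N (by simp [ha])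
    simpa only [this, Option.elim_none] using slotOp_le hq1 hmono _
  | some i =>
    simp only [Option.elim_some]
    split_ifs with he
    · exact hmono fun c => tail_sub_one_le_tail_succ N ha c
    · have : π.tail k (n + 1) ω = π.tail k n ω :=
        tail_succ_of_not_success N (by simp_all)
      rw [this]

theorem IsGreedy.lintegral_slotOp_tail {π : N.Policy C} (hG : π.IsGreedy)
    (hq : ∀ i, ENNReal.ofReal (N.p i) = q) (hq1 : q ≤ 1)
    {f : (ℕ → ℕ) → ℝ≥0∞} (hf : Measurable f) {k n : ℕ} (hk : k < N.K) (hn : n < N.T) :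
    ∫⁻ ω, slotOp q f (π.tail k n ω) ∂μ = ∫⁻ ω, f (π.tail k (n + 1) ω) ∂μ := by
  rw [← π.lintegral_slotOp_tail hq hf]
  refine lintegral_congr fun ω => ?_
  have hg := hG k hk n hn ω
  cases ha : π.act (N.slot k n) ω with
  | none =>
    rw [ha] at hg
    have h : π.tail k (n + 1) ω = π.tail k n ω :=
      tail_succ_of_not_success N (by simp [ha])
    have h0 : π.tail k n ω = 0 := tail_eq_zero_of_all_delivered N hg
    simp only [h, h0, Option.elim_none, slotOp_eq_of_eq_zero hq1 f]
  | some i =>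
    rw [ha] at hg
    simp only [Option.elim_some]
    split_ifs with he
    · exact congrArg f (tail_succ_of_success N ha he hg.1 hg.2).symm
    · have : π.tail k (n + 1) ω = π.tail k n ω :=
        tail_succ_of_not_success N (by simp_all)
      rw [this]

theorem lintegral_frameOp_tail_le (hq : ∀ i, ENNReal.ofReal (N.p i) = q) (hq1 : q ≤ 1)
    {f : (ℕ → ℕ) → ℝ≥0∞} (hf : Measurable f) (hmono : Monotone f) (k : ℕ) :
    ∫⁻ ω, N.frameOp q f (π.tail k 0 ω) ∂μ ≤ ∫⁻ ω, f (π.tail (k + 1) 0 ω) ∂μ := by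
  simp only [tail_succ_zero, frameOp]
  suffices h : ∀ n ≤ N.T, ∫⁻ ω, (slotOp q)^[N.T] (fun x => f (N.shift x)) (π.tail k 0 ω) ∂μ ≤
      ∫⁻ ω, (slotOp q)^[N.T - n] (fun x => f (N.shift x)) (π.tail k n ω) ∂μ by
    simpa using h N.T le_rfl
  intro n hn
  induction n with
  | zero => exact le_rfl
  | succ n ih =>
    refine (ih (by omega)).trans ?_
    rw [show N.T - n = (N.T - (n + 1)) + 1 by omega, Function.iterate_succ_apply']
    exact π.lintegral_slotOp_tail_le hq hq1
      (Measurable.slotOp_iterate (hf.comp N.measurable_shift) _)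
      (Monotone.slotOp_iterate (hmono.comp N.monotone_shift) _) k n

theorem IsGreedy.lintegral_frameOp_tail {π : N.Policy C} (hG : π.IsGreedy)
    (hq : ∀ i, ENNReal.ofReal (N.p i) = q) (hq1 : q ≤ 1)
    {f : (ℕ → ℕ) → ℝ≥0∞} (hf : Measurable f) {k : ℕ} (hk : k < N.K) :
    ∫⁻ ω, N.frameOp q f (π.tail k 0 ω) ∂μ = ∫⁻ ω, f (π.tail (k + 1) 0 ω) ∂μ := by
  simp only [Policy.tail_succ_zero, frameOp]
  suffices h : ∀ n ≤ N.T, ∫⁻ ω, (slotOp q)^[N.T] (fun x => f (N.shift x)) (π.tail k 0 ω) ∂μ =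
      ∫⁻ ω, (slotOp q)^[N.T - n] (fun x => f (N.shift x)) (π.tail k n ω) ∂μ by
    simpa using h N.T le_rfl
  intro n hn
  induction n with
  | zero => rfl
  | succ n ih =>
    rw [ih (by omega), show N.T - n = (N.T - (n + 1)) + 1 by omega, Function.iterate_succ_apply']
    exact hG.lintegral_slotOp_tail hq hq1
      (Measurable.slotOp_iterate (hf.comp N.measurable_shift) _) hk (by omega)

theorem lintegral_frameOp_iterate_le (hq : ∀ i, ENNReal.ofReal (N.p i) = q) (hq1 : q ≤ 1)
    (k : ℕ) {f : (ℕ → ℕ) → ℝ≥0∞} (hf : Measurable f) (hmono : Monotone f) :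
    ∫⁻ ω, (N.frameOp q)^[k] f (π.tail 0 0 ω) ∂μ ≤ ∫⁻ ω, f (π.tail k 0 ω) ∂μ := by
  induction k generalizing f with
  | zero => exact le_rfl
  | succ k ih =>
    exact (ih (N.measurable_frameOp hf) (N.monotone_frameOp hmono)).trans
      (π.lintegral_frameOp_tail_le hq hq1 hf hmono k)

theorem IsGreedy.lintegral_frameOp_iterate {π : N.Policy C} (hG : π.IsGreedy)
    (hq : ∀ i, ENNReal.ofReal (N.p i) = q) (hq1 : q ≤ 1)
    {k : ℕ} (hk : k ≤ N.K) {f : (ℕ → ℕ) → ℝ≥0∞} (hf : Measurable f) :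
    ∫⁻ ω, (N.frameOp q)^[k] f (π.tail 0 0 ω) ∂μ = ∫⁻ ω, f (π.tail k 0 ω) ∂μ := by
  induction k generalizing f with
  | zero => rfl
  | succ k ih =>
    exact (ih (by omega) (N.measurable_frameOp hf)).trans
      (hG.lintegral_frameOp_tail hq hq1 hf hk)

end Policy

end AoINetwork

namespace AoINetwork

section GreedyPolicy

variable {N : AoINetwork} {Ω : Type*} [mΩ : MeasurableSpace Ω] {μ : Measure Ω} (C : N.Channels μ)

/-- The information given by the states of all channels in the earlier slots. -/
def Channels.history : Filtration ℕ mΩ where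
  seq t := ⨆ x ∈ {x : ℕ × Fin N.M | x.1 < t}, MeasurableSpace.comap (C.E x.1 x.2) ⊤
  mono' s _ h := biSup_mono fun x (hx : x.1 < s) => lt_of_lt_of_le hx h
  le' _ := iSup₂_le fun x _ => (C.measurable_E x.1 x.2).comap_le

theorem Channels.measurable_E_history {s t : ℕ} (h : s < t) (i : Fin N.M) :
    Measurable[C.history t] (C.E s i) :=
  measurable_iff_comap_le.2 <| le_iSup₂_of_le (f := fun (x : ℕ × Fin N.M)
    (_ : x ∈ {x : ℕ × Fin N.M | x.1 < t}) => MeasurableSpace.comap (C.E x.1 x.2) ⊤) (s, i) h le_rfl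

theorem Channels.indep_history (t : ℕ) :
    Indep (C.history t)
      (⨆ (s : ℕ) (_ : t ≤ s) (i : Fin N.M), MeasurableSpace.comap (C.E s i) ⊤) μ := by
  have h := indep_iSup_of_disjoint
    (m := fun x : ℕ × Fin N.M => MeasurableSpace.comap (C.E x.1 x.2) ⊤)
    (fun x => (C.measurable_E x.1 x.2).comap_le) C.indep_E
    (S := {x | x.1 < t}) (T := {x | t ≤ x.1})
    (Set.disjoint_left.2 fun x (hx : x.1 < t) (hx' : t ≤ x.1) => absurd hx hx'.not_gt)
  refine indep_of_indep_of_le_right h ?_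
  exact iSup_le fun s => iSup_le fun hs => iSup_le fun i =>
    le_iSup₂_of_le (f := fun (x : ℕ × Fin N.M) (_ : x ∈ {x : ℕ × Fin N.M | t ≤ x.1}) =>
      MeasurableSpace.comap (C.E x.1 x.2) ⊤) (s, i) hs le_rfl

theorem Channels.measurableSet_of_history {β : Type*} (g : (ℕ → Fin N.M → Bool) → β) (t : ℕ)
    (hg : ∀ e e', (∀ s < t, e s = e' s) → g e = g e') (b : β) :
    MeasurableSet[C.history t] {ω | g (fun s i => C.E s i ω) = b} := by
  let R : Ω → Fin t → Fin N.M → Bool := fun ω s i => C.E s i ω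
  have hR : Measurable[C.history t] R :=
    @measurable_pi_lambda _ _ _ (C.history t) _ _ fun s =>
      @measurable_pi_lambda _ _ _ (C.history t) _ _ fun i => C.measurable_E_history s.2 i
  let ext : (Fin t → Fin N.M → Bool) → ℕ → Fin N.M → Bool :=
    fun r s i => if h : s < t then r ⟨s, h⟩ i else false
  have : {ω | g (fun s i => C.E s i ω) = b} = R ⁻¹' {r | g (ext r) = b} := by
    ext ω
    have : g (fun s i => C.E s i ω) = g (ext (R ω)) := hg _ _ fun s hs => by
      funext i
      simp [ext, R, hs]
    simp [this]
  rw [this]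
  exact hR (Set.toFinite _).measurableSet

/-- The greedy policy that observes the channels of the past. -/
noncomputable def greedyPolicy : N.Policy C where
  info := C.history
  act t ω := N.greedyAct (fun s i => C.E s i ω) t
  act_measurable t a := C.measurableSet_of_history (fun e => N.greedyAct e t) t
    (fun _ _ h => N.greedyAct_congr h) a
  feedback_measurable t i := by
    refine MeasurableSet.inter ?_ ?_
    · exact C.history.mono (Nat.le_succ t) _ (C.measurableSet_of_history
        (fun e => N.greedyAct e t) t (fun _ _ h => N.greedyAct_congr h) (some i))
    · exact C.measurable_E_history (Nat.lt_succ_self t) i (measurableSet_singleton true)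
  nonanticipative := C.indep_history
  undelivered k n hn ω i h := by
    have hspec := N.oldest_spec
      (N.delivered (N.greedyAct fun s i => C.E s i ω) (fun s i => C.E s i ω) k n)
      (N.age (N.greedyAct fun s i => C.E s i ω) (fun s i => C.E s i ω) k)
    rw [← N.greedyAct_slot _ hn, h] at hspec
    exact hspec.1

theorem greedyPolicy_isGreedy : (greedyPolicy C).IsGreedy := fun k _ n hn ω => by
  have hspec := N.oldest_spec
    (N.delivered (N.greedyAct fun s i => C.E s i ω) (fun s i => C.E s i ω) k n)
    (N.age (N.greedyAct fun s i => C.E s i ω) (fun s i => C.E s i ω) k)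
  rw [← N.greedyAct_slot _ hn] at hspec
  exact hspec

end GreedyPolicy

namespace Policy

variable {N : AoINetwork} {Ω : Type*} [MeasurableSpace Ω] {μ : Measure Ω} [IsProbabilityMeasure μ]
  {C : N.Channels μ}

theorem integrable_age (π : N.Policy C) (k : ℕ) (i : Fin N.M) :
    Integrable (fun ω => (π.age k i ω : ℝ)) μ := by
  refine Integrable.of_bound (C := ((N.h₁ i + k : ℕ) : ℝ)) ?_ (ae_of_all _ fun ω => ?_)
  · exact (measurable_from_top.comp
      ((π.measurable_age k i).mono (π.info.le _) le_rfl)).aestronglyMeasurable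
  · rw [Real.norm_of_nonneg (Nat.cast_nonneg _)]
    exact_mod_cast N.age_le _ _ k i

theorem integrable_J (π : N.Policy C) : Integrable π.J μ :=
  (integrable_finsetSum _ fun k _ => integrable_finsetSum _ fun i _ =>
    (π.integrable_age k i).const_mul (N.α i)).const_mul _

/-- The total age at the start of a frame as a function of the tail counts. -/
theorem ofReal_sum_integral_age (π : N.Policy C) (k B : ℕ) (hB : ∀ i, N.h₁ i + k ≤ B) :
    ENNReal.ofReal (∑ i, ∫ ω, (π.age k i ω : ℝ) ∂μ) =
      ∫⁻ ω, ∑ c ∈ Finset.range B, (π.tail k 0 ω c : ℝ≥0∞) ∂μ := by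
  rw [← integral_finsetSum _ fun i _ => π.integrable_age k i,
    ofReal_integral_eq_lintegral_ofReal (integrable_finsetSum _ fun i _ => π.integrable_age k i)
      (ae_of_all _ fun ω => Finset.sum_nonneg fun i _ => Nat.cast_nonneg _)]
  refine lintegral_congr fun ω => ?_
  have h : ∑ i, π.age k i ω = ∑ c ∈ Finset.range B, π.tail k 0 ω c :=
    N.sum_age_eq_sum_tail _ _ fun i => (N.age_le _ _ k i).trans (hB i)
  rw [← Nat.cast_sum, h, ENNReal.ofReal_natCast, Nat.cast_sum]

/-- In a symmetric network a greedy policy minimizes the expected total age at the start of each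
frame. -/
theorem IsGreedy.sum_integral_age_le {G : N.Policy C} (hG : G.IsGreedy) {p : ℝ} (hp : p ≤ 1)
    (hNp : ∀ i, N.p i = p) {Ω' : Type*} [MeasurableSpace Ω'] {μ' : Measure Ω'}
    [IsProbabilityMeasure μ'] {C' : N.Channels μ'} (π : N.Policy C') {k : ℕ} (hk : k ≤ N.K) :
    ∑ i, ∫ ω, (G.age k i ω : ℝ) ∂μ ≤ ∑ i, ∫ ω, (π.age k i ω : ℝ) ∂μ' := by
  have hB : ∀ i, N.h₁ i + k ≤ (∑ i, N.h₁ i) + k := fun i =>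
    Nat.add_le_add_right (Finset.single_le_sum (fun _ _ => Nat.zero_le _) (Finset.mem_univ i)) k
  rw [← ENNReal.ofReal_le_ofReal_iff
    (Finset.sum_nonneg fun i _ => integral_nonneg fun ω => Nat.cast_nonneg _),
    G.ofReal_sum_integral_age k _ hB, π.ofReal_sum_integral_age k _ hB]
  set f : (ℕ → ℕ) → ℝ≥0∞ := fun x => ∑ c ∈ Finset.range ((∑ i, N.h₁ i) + k), (x c : ℝ≥0∞)
  have hf : Measurable f := Finset.measurable_sum _ fun c _ =>
    measurable_from_top.comp (measurable_pi_apply c)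
  have hmono : Monotone f := fun x y h =>
    Finset.sum_le_sum fun c _ => Nat.cast_le.2 (h c)
  have hq : ∀ i, ENNReal.ofReal (N.p i) = ENNReal.ofReal p := fun i => by rw [hNp i]
  have hq1 : ENNReal.ofReal p ≤ 1 := ENNReal.ofReal_le_one.2 hp
  have h₁ := hG.lintegral_frameOp_iterate hq hq1 hk hf
  have h₂ := π.lintegral_frameOp_iterate_le hq hq1 k hf hmono
  have hconst : ∀ ω ω', G.tail 0 0 ω = π.tail 0 0 ω' := fun ω ω' => by
    funext c
    simp only [tail, AoINetwork.tail, delivered_zero, AoINetwork.age]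
  obtain ⟨ω₀⟩ : Nonempty Ω := μ.nonempty_of_neZero
  simp only [fun ω' => (hconst ω₀ ω').symm, lintegral_const, measure_univ, mul_one] at h₂
  obtain ⟨ω₁⟩ : Nonempty Ω' := μ'.nonempty_of_neZero
  simp only [fun ω => (hconst ω ω₁), lintegral_const, measure_univ, mul_one] at h₁ h₂
  exact h₁.symm.trans_le h₂

theorem expectedJ_eq (π : N.Policy C) {α : ℝ} (hNα : ∀ i, N.α i = α) :
    π.expectedJ = 1 / ((N.K : ℝ) * N.M) *
      ∑ k ∈ Finset.range N.K, α * ∑ i, ∫ ω, (π.age k i ω : ℝ) ∂μ := by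
  simp only [expectedJ, J, hNα, ← Finset.mul_sum]
  rw [integral_const_mul, integral_const_mul, integral_finsetSum _ fun k _ =>
    integrable_finsetSum _ fun i _ => π.integrable_age k i]
  congr 2
  exact Finset.sum_congr rfl fun k _ => integral_finsetSum _ fun i _ => π.integrable_age k i

theorem EWSAoI_eq (π : N.Policy C) :
    π.EWSAoI = 1 / ((N.K : ℝ) * N.T * N.M) *
      (∑ _k ∈ Finset.range N.K, ∑ i, N.α i * ((N.T : ℝ) ^ 2 / 2)) + N.T * π.expectedJ := by
  have hT : (N.T : ℝ) ≠ 0 := Nat.cast_ne_zero.2 N.T_pos.ne'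
  have hM : (N.M : ℝ) ≠ 0 := Nat.cast_ne_zero.2 N.M_pos.ne'
  have hK : (N.K : ℝ) ≠ 0 := Nat.cast_ne_zero.2 N.K_pos.ne'
  have hpt : ∀ ω, ∑ k ∈ Finset.range N.K, ∑ i : Fin N.M,
      N.α i * ((N.T : ℝ) ^ 2 / 2 + (N.T : ℝ) ^ 2 * (π.age k i ω : ℝ)) =
      (∑ _k ∈ Finset.range N.K, ∑ i, N.α i * ((N.T : ℝ) ^ 2 / 2)) +
        (N.T : ℝ) ^ 2 * (N.K * N.M) * π.J ω := fun ω => by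
    have : (N.T : ℝ) ^ 2 * (N.K * N.M) * π.J ω = (N.T : ℝ) ^ 2 *
        ∑ k ∈ Finset.range N.K, ∑ i : Fin N.M, N.α i * (π.age k i ω : ℝ) := by
      rw [J]
      field_simp
    rw [this, Finset.mul_sum, ← Finset.sum_add_distrib]
    refine Finset.sum_congr rfl fun k _ => ?_
    rw [Finset.mul_sum, ← Finset.sum_add_distrib]
    exact Finset.sum_congr rfl fun i _ => by ring
  simp only [EWSAoI, hpt]
  rw [integral_add (integrable_const _) (π.integrable_J.const_mul _), integral_const_mul,
    integral_const, probReal_univ, one_smul, expectedJ]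
  field_simp

end Policy

end AoINetwork

theorem mainTheorem1 (N : AoINetwork) (p α : ℝ) (hp : p ∈ Set.Ioc (0 : ℝ) 1) (hα : 0 < α)
    (hNp : ∀ i, N.p i = p) (hNα : ∀ i, N.α i = α)
    {Ω : Type*} [MeasurableSpace Ω] (μ : Measure Ω) [IsProbabilityMeasure μ]
    (C : N.Channels μ) :
    (∃ G : N.Policy C, G.IsGreedy) ∧
    ∀ G : N.Policy C, G.IsGreedy →
      ∀ {Ω' : Type*} [MeasurableSpace Ω'] (μ' : Measure Ω') [IsProbabilityMeasure μ']
        (C' : N.Channels μ') (π : N.Policy C'),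
        Integrable G.J μ ∧ Integrable π.J μ' ∧
        G.expectedJ ≤ π.expectedJ ∧ G.EWSAoI ≤ π.EWSAoI := by
  refine ⟨⟨AoINetwork.greedyPolicy C, AoINetwork.greedyPolicy_isGreedy C⟩, ?_⟩
  intro G hG Ω' _ μ' _ C' π
  have hJ : G.expectedJ ≤ π.expectedJ := by
    rw [G.expectedJ_eq hNα, π.expectedJ_eq hNα]
    refine mul_le_mul_of_nonneg_left (Finset.sum_le_sum fun k hk =>
      mul_le_mul_of_nonneg_left ?_ hα.le) (by positivity)
    exact hG.sum_integral_age_le hp.2 hNp π (Finset.mem_range.1 hk).le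
  refine ⟨G.integrable_J, π.integrable_J, hJ, ?_⟩
  rw [G.EWSAoI_eq, π.EWSAoI_eq]
  gcongr
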